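/- Let $\Gamma$ be a discrete group and let $A$ be a separable unital $\Gamma$-$C^*$-algebra, i.e. a separable unital $C^*$-algebra with $1\neq 0$ on which $\Gamma$ acts by $*$-automorphisms. Let $S(A)$ denote its state space with the weak$^*$ topology and the corresponding Borel $\sigma$-algebra. Let $(Y,\eta)$ be a probability space on which $\Gamma$ acts measurably (each $s\in\Gamma$ acts by a measurable map; $\eta$ need not be invariant or quasi-invariant), and let $\mu\in\mathrm{Prob}(\Gamma)$, i.e. $\mu:\Gamma\to[0,1]$ with $\sum_{s\in\Gamma}\mu(s)=1$. Then there exists a measurable map $\varphi:Y\to S(A)$ that is $\mu$-stationary: for $\eta$-almost every $y\in Y$ and every $a\in A$, \[ \sum_{s\in\Gamma}\mu(s)\,\varphi(s^{-1}y)(s^{-1}a)=\varphi(y)(a), \] the series being (absolutely) convergent. -/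

import Mathlib

open scoped ComplexOrder

/-- The state space `S(A)` of a unital C⋆-algebra `A`: the positive linear functionals `f` on `A`
with `f 1 = 1`, as a subset of the dual of `A` with its weak-⋆ topology. -/
def stateSpace (A : Type*) [CStarAlgebra A] : Set (WeakDual ℂ A) :=
  {f | (∀ a : A, 0 ≤ f (star a * a)) ∧ f 1 = 1}

/-- `S(A)` carries the Borel σ-algebra of the weak-⋆ topology. -/
noncomputable instance stateSpace.instMeasurableSpace (A : Type*) [CStarAlgebra A] :
    MeasurableSpace (stateSpace A) :=
  borel (stateSpace A)

instance stateSpace.instBorelSpace (A : Type*) [CStarAlgebra A] : BorelSpace (stateSpace A) :=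
  ⟨rfl⟩

/-- A map `φ : Y → S(A)` is `μ`-stationary (with respect to `η`) if for `η`-almost every `y`, for
all `a`, the series `∑ s, μ(s) φ(s⁻¹ y)(s⁻¹ a)` converges to `φ(y)(a)`. Here `Γ` acts on `A` by
⋆-automorphisms through `α`, so `s⁻¹ a` is `α s⁻¹ a`. -/
def IsStationaryStateMap {Γ A Y : Type*} [Group Γ] [CStarAlgebra A] [MulAction Γ Y]
    [MeasurableSpace Y] (α : Γ →* (A ≃⋆ₐ[ℂ] A)) (μ : PMF Γ) (η : MeasureTheory.Measure Y)
    (φ : Y → stateSpace A) : Prop :=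
  ∀ᵐ y ∂η, ∀ a : A,
    HasSum (fun s : Γ => ((μ s).toReal : ℂ) * (φ (s⁻¹ • y) : WeakDual ℂ A) (α s⁻¹ a))
      ((φ y : WeakDual ℂ A) a)

/-! Averaging, `(Pψ)(y)(a) = ∑ μ(s) ψ(s⁻¹y)(s⁻¹a)`, is an affine operator on genuine maps from `Y`
to states, so no quasi-invariance is needed to define it. Cesàro means of the orbit of a constant
map are fixed up to `2/(n+1)`. Hence the sets of approximately fixed measurable maps are nonempty,
decreasing and closed under midpoints. Evaluation on a dense sequence places these sets in a ball of
a Hilbert space `L²`. There the parallelogram law makes near-minimal elements Cauchy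
(`exists_cauchySeq_mem_of_antitone`), and a subsequence converges almost everywhere
(`exists_ae_tendsto_of_antitone`). This pointwise convergence lets dominated convergence pass `P` to
the limit (`averageMap_eq_of_tendsto`). States are handled as unital contractions, a form in which
compactness and averaging are immediate. -/

open MeasureTheory Filter Topology

/-! ### Unital contractive functionals: positivity, compactness, measurability. -/

section NormState

variable {A : Type*} [CStarAlgebra A]

/-- The unital contractive functionals on `A`. -/
def normState (A : Type*) [CStarAlgebra A] : Set (WeakDual ℂ A) :=
  {f | (∀ a : A, ‖f a‖ ≤ ‖a‖) ∧ f 1 = 1}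

/-- Since `0 ≤ a*a ≤ ‖a*a‖`, the difference is positive and below `‖a*a‖`. A unital contraction then
has nonnegative real part on `a*a`. -/
theorem norm_norm_smul_one_sub_star_mul_self_le (a : A) :
    ‖(‖star a * a‖ : ℂ) • (1 : A) - star a * a‖ ≤ ‖star a * a‖ := by
  nontriviality A
  let _ := CStarAlgebra.spectralOrder A
  let _ := CStarAlgebra.spectralOrderedRing A
  have hsa : IsSelfAdjoint (star a * a) := .star_mul_self a
  have h1 := hsa.le_algebraMap_norm_self
  have h2 : (algebraMap ℝ A ‖star a * a‖) = (‖star a * a‖ : ℂ) • (1 : A) := by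
    rw [Algebra.algebraMap_eq_smul_one, Complex.coe_smul]
  rw [h2] at h1
  have h3 := CStarAlgebra.norm_le_norm_of_nonneg_of_le (sub_nonneg.mpr h1)
    (sub_le_self _ (star_mul_self_nonneg a))
  simpa [norm_smul] using h3

/-- By the C⋆-identity, as the cross terms cancel. A unital contraction is thereby real on
self-adjoint elements, because the term linear in `t` must stay bounded. -/
theorem norm_add_I_smul_one_sq_le {b : A} (hb : IsSelfAdjoint b) (t : ℝ) :
    ‖b + (t * Complex.I) • (1 : A)‖ ^ 2 ≤ ‖b‖ ^ 2 + t ^ 2 := by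
  rcases subsingleton_or_nontrivial A with _ | _
  · simpa [Subsingleton.elim (b + _) 0] using add_nonneg (sq_nonneg ‖b‖) (sq_nonneg t)
  have h : star (b + (t * Complex.I) • (1 : A)) * (b + (t * Complex.I) • (1 : A))
      = b * b + ((t ^ 2 : ℝ) : ℂ) • (1 : A) := by
    have hI : -(t * Complex.I) * (t * Complex.I) = ((t ^ 2 : ℝ) : ℂ) := by
      push_cast; ring_nf; simp
    rw [← hI]
    simp only [star_add, star_smul, star_one, hb.star_eq, star_mul', RCLike.star_def,
      Complex.conj_ofReal, Complex.conj_I, add_mul, mul_add, smul_mul_assoc, mul_smul_comm, one_mul,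
      mul_one, smul_add, smul_smul]
    module
  rw [sq, ← CStarRing.norm_star_mul_self, h]
  refine (norm_add_le _ _).trans ?_
  gcongr
  · simpa [sq] using norm_mul_le b b
  · simp [norm_smul]

theorem normState_subset_stateSpace : normState A ⊆ stateSpace A := by
  rintro f ⟨hf, h1⟩
  refine ⟨fun a => ?_, h1⟩
  rw [Complex.nonneg_iff]
  set b := star a * a with hb
  have hbsa : IsSelfAdjoint b := .star_mul_self a
  constructor
  · have h := (hf _).trans (norm_norm_smul_one_sub_star_mul_self_le a)
    rw [map_sub, map_smul, h1, smul_eq_mul, mul_one] at h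
    have h' := (Complex.re_le_norm _).trans h
    simp only [Complex.sub_re, Complex.ofReal_re] at h'
    linarith
  · have key (t : ℝ) : 2 * t * (f b).im ≤ ‖b‖ ^ 2 := by
      have h := pow_le_pow_left₀ (norm_nonneg _) (hf (b + (t * Complex.I) • (1 : A))) 2
      have h' := h.trans (norm_add_I_smul_one_sq_le hbsa t)
      rw [map_add, map_smul, h1, smul_eq_mul, mul_one, ← Complex.normSq_eq_norm_sq,
        Complex.normSq_apply] at h'
      simp at h'
      nlinarith [sq_nonneg (f b).re, sq_nonneg (f b).im]
    by_contra hne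
    have hne' : (f b).im ≠ 0 := fun h => hne h.symm
    -- This `t` turns the left side of `key` into `‖b‖ ^ 2 + 1`.
    have h := key ((‖b‖ ^ 2 + 1) / (2 * (f b).im))
    have : 2 * ((‖b‖ ^ 2 + 1) / (2 * (f b).im)) * (f b).im = ‖b‖ ^ 2 + 1 := by field_simp
    linarith

theorem isCompact_normState : IsCompact (normState A) := by
  have h : normState A = WeakDual.toStrongDual ⁻¹' Metric.closedBall (0 : StrongDual ℂ A) 1 ∩
      {f | f 1 = 1} := by
    ext f
    simp only [normState, Set.mem_ofPred_eq, Set.mem_inter_iff, Set.mem_preimage,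
      mem_closedBall_zero_iff]
    refine and_congr_left fun _ => ⟨fun h => ?_, fun h a => ?_⟩
    · exact ContinuousLinearMap.opNorm_le_bound _ zero_le_one fun a => by simpa using h a
    · simpa using (WeakDual.toStrongDual f).le_of_opNorm_le h a
  rw [h]
  exact (WeakDual.isCompact_closedBall 0 1).inter_right
    (isClosed_eq (WeakDual.eval_continuous 1) continuous_const)

instance : CompactSpace (normState A) := isCompact_iff_compactSpace.mp isCompact_normState

theorem normState_nonempty [Nontrivial A] : (normState A).Nonempty := by
  obtain ⟨g, hg, h1⟩ := exists_dual_vector'' ℂ (1 : A)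
  exact ⟨StrongDual.toWeakDual g, fun a => by simpa using g.le_of_opNorm_le hg a, by simpa using h1⟩

theorem convex_normState : Convex ℝ (normState A) := by
  rintro f ⟨hf, hf1⟩ g ⟨hg, hg1⟩ a b ha hb hab
  refine ⟨fun x => ?_, ?_⟩
  · change ‖a • f x + b • g x‖ ≤ _
    calc ‖a • f x + b • g x‖ ≤ a * ‖x‖ + b * ‖x‖ := by
          refine (norm_add_le _ _).trans ?_
          rw [norm_smul, norm_smul, Real.norm_of_nonneg ha, Real.norm_of_nonneg hb]
          gcongr
          exacts [hf x, hg x]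
      _ = ‖x‖ := by rw [← add_mul, hab, one_mul]
  · change a • f 1 + b • g 1 = 1
    rw [hf1, hg1, ← add_smul, hab, one_smul]

variable (A) in
/-- A sequence in the unit ball of `A` whose linear span is dense. -/
noncomputable def unitBallSeq [TopologicalSpace.SeparableSpace A] (n : ℕ) : A :=
  (((1 + ‖TopologicalSpace.denseSeq A n‖)⁻¹ : ℝ) : ℂ) • TopologicalSpace.denseSeq A n

theorem norm_unitBallSeq_le [TopologicalSpace.SeparableSpace A] (n : ℕ) :
    ‖unitBallSeq A n‖ ≤ 1 := by
  have h : 0 ≤ ‖TopologicalSpace.denseSeq A n‖ := norm_nonneg _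
  rw [unitBallSeq, norm_smul, Complex.norm_real, Real.norm_of_nonneg (by positivity),
    inv_mul_le_one₀ (by positivity)]
  linarith

/-- The values of a functional along `unitBallSeq`. -/
noncomputable def evalSeq [TopologicalSpace.SeparableSpace A] (f : normState A) (n : ℕ) : ℂ :=
  (f : WeakDual ℂ A) (unitBallSeq A n)

/-- A continuous injection of a compact space into a Hausdorff one. It yields metrizability, a
coordinatewise measurability test, and limits that remain functionals. -/
theorem isClosedEmbedding_evalSeq [TopologicalSpace.SeparableSpace A] :
    IsClosedEmbedding (evalSeq : normState A → ℕ → ℂ) := by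
  have hc : Continuous (evalSeq : normState A → ℕ → ℂ) := continuous_pi fun n =>
    (WeakDual.eval_continuous _).comp continuous_subtype_val
  refine hc.isClosedEmbedding fun f g hfg => Subtype.ext ?_
  have h : (f : WeakDual ℂ A) ∘ TopologicalSpace.denseSeq A =
      (g : WeakDual ℂ A) ∘ TopologicalSpace.denseSeq A := by
    funext n
    have hn := congrFun hfg n
    have hpos : (((1 + ‖TopologicalSpace.denseSeq A n‖)⁻¹ : ℝ) : ℂ) ≠ 0 := by
      have := norm_nonneg (TopologicalSpace.denseSeq A n)
      exact Complex.ofReal_ne_zero.mpr (by positivity)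
    rw [evalSeq, evalSeq, unitBallSeq, map_smul, map_smul] at hn
    exact smul_right_injective ℂ hpos hn
  refine DFunLike.coe_injective ?_
  exact (TopologicalSpace.denseRange_denseSeq A).equalizer
    (map_continuous (f : WeakDual ℂ A)) (map_continuous (g : WeakDual ℂ A)) h

noncomputable instance : MeasurableSpace (normState A) := borel _

instance : BorelSpace (normState A) := ⟨rfl⟩

theorem measurable_normState_apply (a : A) :
    Measurable fun f : normState A => (f : WeakDual ℂ A) a :=
  ((WeakDual.eval_continuous a).comp continuous_subtype_val).measurable

theorem measurable_to_normState [TopologicalSpace.SeparableSpace A] {Y : Type*}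
    [MeasurableSpace Y] {ψ : Y → normState A}
    (h : ∀ a : A, Measurable fun y => (ψ y : WeakDual ℂ A) a) : Measurable ψ :=
  isClosedEmbedding_evalSeq.measurableEmbedding.measurable_comp_iff.mp
    (measurable_pi_iff.mpr fun _ => h _)

end NormState

/-! ### Near-minimizers of the norm in a Hilbert space. -/

section NearMinimizers

variable {H : Type*} [NormedAddCommGroup H] [InnerProductSpace ℝ H]

/-- Near-minimal norm elements of a bounded decreasing sequence of midpoint-convex sets form a
Cauchy sequence. -/
theorem exists_cauchySeq_mem_of_antitone {C : ℕ → Set H} (hne : ∀ n, (C n).Nonempty)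
    (hanti : Antitone C) (hmid : ∀ n, ∀ x ∈ C n, ∀ y ∈ C n, (2⁻¹ : ℝ) • (x + y) ∈ C n)
    {R : ℝ} (hR : ∀ n, ∀ x ∈ C n, ‖x‖ ≤ R) :
    ∃ v : ℕ → H, (∀ n, v n ∈ C n) ∧ CauchySeq v := by
  set d : ℕ → ℝ := fun n => sInf ((fun x => ‖x‖ ^ 2) '' C n) with hd
  have hbdd (n : ℕ) : BddBelow ((fun x => ‖x‖ ^ 2) '' C n) :=
    ⟨0, by rintro _ ⟨x, -, rfl⟩; positivity⟩
  have hle {n : ℕ} {x : H} (hx : x ∈ C n) : d n ≤ ‖x‖ ^ 2 := csInf_le (hbdd n) ⟨x, hx, rfl⟩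
  have hmono : Monotone d := fun m n hmn =>
    csInf_le_csInf (hbdd m) ((hne n).image _) (Set.image_mono (hanti hmn))
  have hbound (n : ℕ) : d n ≤ R ^ 2 := by
    obtain ⟨x, hx⟩ := hne n
    exact (hle hx).trans (pow_le_pow_left₀ (norm_nonneg x) (hR n x hx) 2)
  have hlim := tendsto_atTop_ciSup hmono ⟨R ^ 2, by rintro _ ⟨n, rfl⟩; exact hbound n⟩
  set D := ⨆ n, d n
  have hdD (n : ℕ) : d n ≤ D := hmono.ge_of_tendsto hlim n
  have hex (n : ℕ) : ∃ x ∈ C n, ‖x‖ ^ 2 < d n + 1 / ((n : ℝ) + 1) := by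
    obtain ⟨_, ⟨x, hx, rfl⟩, hlt⟩ := exists_lt_of_csInf_lt ((hne n).image fun x => ‖x‖ ^ 2)
      (lt_add_of_pos_right (d n) (Nat.one_div_pos_of_nat (α := ℝ) (n := n)))
    exact ⟨x, hx, hlt⟩
  choose v hv hlt using hex
  refine ⟨v, hv, ?_⟩
  have hdist (n m : ℕ) (hnm : n ≤ m) :
      ‖v n - v m‖ ^ 2 ≤ 4 * (D - d n) + 4 * (1 / ((n : ℝ) + 1)) := by
    -- The midpoint lies in `C n`, so its squared norm is at least `d n`, while those of `v n` and
    -- `v m` barely exceed `d n` and `d m ≤ D`.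
    have h1 := parallelogram_law_with_norm ℝ (v n) (v m)
    have h2 := hle (hmid n _ (hv n) _ (hanti hnm (hv m)))
    rw [norm_smul, mul_pow] at h2
    norm_num at h2
    have h3 : 1 / ((m : ℝ) + 1) ≤ 1 / ((n : ℝ) + 1) := Nat.one_div_le_one_div hnm
    nlinarith [hlt n, hlt m, hdD n, hdD m]
  refine Metric.cauchySeq_iff'.mpr fun ε hε => ?_
  have hz : Tendsto (fun n : ℕ => 4 * (D - d n) + 4 * (1 / ((n : ℝ) + 1))) atTop (𝓝 0) := by
    simpa using (((tendsto_const_nhds (x := D)).sub hlim).const_mul 4).add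
      ((tendsto_one_div_add_atTop_nhds_zero_nat (𝕜 := ℝ)).const_mul 4)
  obtain ⟨N, hN⟩ := (hz.eventually (gt_mem_nhds (pow_pos hε 2))).exists
  refine ⟨N, fun n hn => ?_⟩
  rw [dist_comm, dist_eq_norm]
  exact lt_of_pow_lt_pow_left₀ 2 hε.le ((hdist N n hn).trans_lt hN)

end NearMinimizers

/-! ### The averaging operator and its approximate fixed points. -/

section Averaging

variable {Γ A Y : Type*} [CStarAlgebra A]

theorem PMF.hasSum_toReal (μ : PMF Γ) : HasSum (fun s => (μ s).toReal) 1 := by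
  have h := ENNReal.hasSum_toReal (f := μ) (by simp [μ.tsum_coe])
  rwa [← ENNReal.tsum_toReal_eq fun s => μ.apply_ne_top s, μ.tsum_coe, ENNReal.toReal_one] at h

theorem norm_toReal_mul_normState_le (μ : PMF Γ) (F : Γ → normState A) (a : Γ → A) {r : ℝ}
    (ha : ∀ s, ‖a s‖ ≤ r) (s : Γ) :
    ‖((μ s).toReal : ℂ) * (F s : WeakDual ℂ A) (a s)‖ ≤ (μ s).toReal * r := by
  rw [norm_mul, Complex.norm_real, Real.norm_of_nonneg ENNReal.toReal_nonneg]
  gcongr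
  exact ((F s).2.1 _).trans (ha s)

variable [Group Γ]

theorem exists_hasSum_normState (α : Γ →* (A ≃⋆ₐ[ℂ] A)) (μ : PMF Γ) (F : Γ → normState A) :
    ∃ f : normState A, ∀ a : A,
      HasSum (fun s => ((μ s).toReal : ℂ) * (F s : WeakDual ℂ A) (α s⁻¹ a))
        ((f : WeakDual ℂ A) a) := by
  have hle (a : A) := norm_toReal_mul_normState_le μ F (fun s => α s⁻¹ a)
    (fun s => (StarAlgEquiv.norm_map (α s⁻¹) a).le)
  have hs (a : A) : Summable fun s => ((μ s).toReal : ℂ) * (F s : WeakDual ℂ A) (α s⁻¹ a) :=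
    .of_norm_bounded (μ.hasSum_toReal.summable.mul_right ‖a‖) (hle a)
  have hnorm (a : A) : ‖∑' s, ((μ s).toReal : ℂ) * (F s : WeakDual ℂ A) (α s⁻¹ a)‖ ≤ ‖a‖ := by
    simpa using tsum_of_norm_bounded (μ.hasSum_toReal.mul_right ‖a‖) (hle a)
  let g : A →ₗ[ℂ] ℂ :=
    { toFun := fun a => ∑' s, ((μ s).toReal : ℂ) * (F s : WeakDual ℂ A) (α s⁻¹ a)
      map_add' := fun a b => by
        rw [← (hs a).tsum_add (hs b)]
        simp only [map_add, mul_add]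
      map_smul' := fun c a => by
        rw [RingHom.id_apply, smul_eq_mul, ← tsum_mul_left]
        simp only [map_smul, smul_eq_mul, mul_left_comm] }
  refine ⟨⟨StrongDual.toWeakDual (g.mkContinuous 1 fun a => (hnorm a).trans_eq (one_mul _).symm), hnorm, ?_⟩,
    fun a => (hs a).hasSum⟩
  change ∑' s, ((μ s).toReal : ℂ) * (F s : WeakDual ℂ A) (α s⁻¹ 1) = 1
  have h (s : Γ) : (F s : WeakDual ℂ A) 1 = 1 := (F s).2.2
  simp only [map_one, h, mul_one]
  exact_mod_cast (Complex.hasSum_ofReal.mpr μ.hasSum_toReal).tsum_eq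

variable [MulAction Γ Y]

/-- The `μ`-average of a map into the contractive unital functionals. -/
noncomputable def averageMap (α : Γ →* (A ≃⋆ₐ[ℂ] A)) (μ : PMF Γ) (ψ : Y → normState A) (y : Y) :
    normState A :=
  (exists_hasSum_normState α μ fun s => ψ (s⁻¹ • y)).choose

theorem hasSum_averageMap (α : Γ →* (A ≃⋆ₐ[ℂ] A)) (μ : PMF Γ) (ψ : Y → normState A) (y : Y)
    (a : A) :
    HasSum (fun s : Γ => ((μ s).toReal : ℂ) * (ψ (s⁻¹ • y) : WeakDual ℂ A) (α s⁻¹ a))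
      ((averageMap α μ ψ y : WeakDual ℂ A) a) :=
  (exists_hasSum_normState α μ fun s => ψ (s⁻¹ • y)).choose_spec a

theorem measurable_averageMap [TopologicalSpace.SeparableSpace A] [MeasurableSpace Y]
    [MeasurableConstSMul Γ Y] (α : Γ →* (A ≃⋆ₐ[ℂ] A)) (μ : PMF Γ) {ψ : Y → normState A}
    (hψ : Measurable ψ) : Measurable (averageMap α μ ψ) := by
  refine measurable_to_normState fun a => ?_
  -- `Γ` may be uncountable; restricting to the support makes the sum a limit along a countably
  -- generated filter.
  have : Countable μ.support := μ.support_countable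
  have h (y : Y) : HasSum (fun s : μ.support =>
      ((μ s).toReal : ℂ) * (ψ ((s : Γ)⁻¹ • y) : WeakDual ℂ A) (α (s : Γ)⁻¹ a))
      ((averageMap α μ ψ y : WeakDual ℂ A) a) := by
    refine (hasSum_subtype_iff_of_support_subset (f := fun s : Γ =>
      ((μ s).toReal : ℂ) * (ψ (s⁻¹ • y) : WeakDual ℂ A) (α s⁻¹ a)) fun s hs => ?_).mpr
      (hasSum_averageMap α μ ψ y a)
    rw [PMF.mem_support_iff]
    rintro h0
    simp [h0] at hs
  refine measurable_of_tendsto_metrizable' atTop (f := fun (t : Finset μ.support) y =>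
    ∑ s ∈ t, ((μ s).toReal : ℂ) * (ψ ((s : Γ)⁻¹ • y) : WeakDual ℂ A) (α (s : Γ)⁻¹ a))
    (fun t => Finset.measurable_sum _ fun s _ => ?_) (tendsto_pi_nhds.mpr fun y => h y)
  exact ((measurable_normState_apply _).comp (hψ.comp (measurable_const_smul _))).const_mul _

/-- The measurable maps into the contractive unital functionals that are `μ`-stationary up to
`2 / (n + 1)`. -/
def almostStationary [MeasurableSpace Y] (α : Γ →* (A ≃⋆ₐ[ℂ] A)) (μ : PMF Γ) (n : ℕ) :
    Set (Y → normState A) :=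
  {ψ | Measurable ψ ∧ ∀ y a, ‖(averageMap α μ ψ y : WeakDual ℂ A) a - (ψ y : WeakDual ℂ A) a‖ ≤
    2 / (n + 1) * ‖a‖}

theorem antitone_almostStationary [MeasurableSpace Y] (α : Γ →* (A ≃⋆ₐ[ℂ] A)) (μ : PMF Γ) :
    Antitone (almostStationary (Y := Y) α μ) := fun m n hmn ψ hψ =>
  ⟨hψ.1, fun y a => (hψ.2 y a).trans (by gcongr)⟩

/-- The pointwise midpoint of two maps into the contractive unital functionals. -/
noncomputable def midpointMap (ψ χ : Y → normState A) (y : Y) : normState A :=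
  ⟨(2⁻¹ : ℝ) • (ψ y : WeakDual ℂ A) + (2⁻¹ : ℝ) • (χ y : WeakDual ℂ A),
    convex_normState (ψ y).2 (χ y).2 (by norm_num) (by norm_num) (by norm_num)⟩

theorem midpointMap_apply (ψ χ : Y → normState A) (y : Y) (a : A) :
    (midpointMap ψ χ y : WeakDual ℂ A) a =
      2⁻¹ * ((ψ y : WeakDual ℂ A) a + (χ y : WeakDual ℂ A) a) := by
  change (2⁻¹ : ℝ) • (ψ y : WeakDual ℂ A) a + (2⁻¹ : ℝ) • (χ y : WeakDual ℂ A) a = _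
  simp only [Complex.real_smul]
  push_cast
  ring

theorem averageMap_midpointMap (α : Γ →* (A ≃⋆ₐ[ℂ] A)) (μ : PMF Γ) (ψ χ : Y → normState A)
    (y : Y) (a : A) :
    (averageMap α μ (midpointMap ψ χ) y : WeakDual ℂ A) a =
      2⁻¹ * ((averageMap α μ ψ y : WeakDual ℂ A) a + (averageMap α μ χ y : WeakDual ℂ A) a) := by
  refine (hasSum_averageMap α μ _ y a).unique ?_
  convert! ((hasSum_averageMap α μ ψ y a).add (hasSum_averageMap α μ χ y a)).mul_left 2⁻¹
    using 2 with s
  rw [midpointMap_apply]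
  ring

theorem midpointMap_mem_almostStationary [TopologicalSpace.SeparableSpace A] [MeasurableSpace Y]
    {α : Γ →* (A ≃⋆ₐ[ℂ] A)} {μ : PMF Γ} {n : ℕ} {ψ χ : Y → normState A}
    (hψ : ψ ∈ almostStationary α μ n) (hχ : χ ∈ almostStationary α μ n) :
    midpointMap ψ χ ∈ almostStationary α μ n := by
  refine ⟨measurable_to_normState fun a => ?_, fun y a => ?_⟩
  · simp only [midpointMap_apply]
    exact (((measurable_normState_apply a).comp hψ.1).add
      ((measurable_normState_apply a).comp hχ.1)).const_mul _
  · rw [averageMap_midpointMap, midpointMap_apply, ← mul_sub, add_sub_add_comm, norm_mul]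
    have h := (norm_add_le _ _).trans (add_le_add (hψ.2 y a) (hχ.2 y a))
    norm_num
    linarith

/-- The Cesàro average of the first `n + 1` terms of a sequence of functionals. -/
noncomputable def cesaroMap (ψ : ℕ → Y → normState A) (n : ℕ) (y : Y) : normState A :=
  ⟨∑ k ∈ Finset.range (n + 1), ((n : ℝ) + 1)⁻¹ • (ψ k y : WeakDual ℂ A),
    convex_normState.sum_mem (fun _ _ => by positivity)
      (by simp [mul_inv_cancel₀ (Nat.cast_add_one_ne_zero (R := ℝ) n)]) fun k _ => (ψ k y).2⟩

theorem cesaroMap_apply (ψ : ℕ → Y → normState A) (n : ℕ) (y : Y) (a : A) :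
    (cesaroMap ψ n y : WeakDual ℂ A) a =
      ((n : ℂ) + 1)⁻¹ * ∑ k ∈ Finset.range (n + 1), (ψ k y : WeakDual ℂ A) a := by
  have h (t : Finset ℕ) : (∑ k ∈ t, ((n : ℝ) + 1)⁻¹ • (ψ k y : WeakDual ℂ A)) a =
      ∑ k ∈ t, ((n : ℂ) + 1)⁻¹ * (ψ k y : WeakDual ℂ A) a := by
    induction t using Finset.cons_induction with
    | empty => rfl
    | cons k t hk ih =>
      rw [Finset.sum_cons, Finset.sum_cons, ← ih]
      change ((n : ℝ) + 1)⁻¹ • (ψ k y : WeakDual ℂ A) a + _ = _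
      rw [Complex.real_smul]
      push_cast
      rfl
  rw [Finset.mul_sum, ← h]
  rfl

theorem averageMap_cesaroMap (α : Γ →* (A ≃⋆ₐ[ℂ] A)) (μ : PMF Γ) (ψ : ℕ → Y → normState A)
    (n : ℕ) (y : Y) (a : A) :
    (averageMap α μ (cesaroMap ψ n) y : WeakDual ℂ A) a =
      (cesaroMap (fun k => averageMap α μ (ψ k)) n y : WeakDual ℂ A) a := by
  refine (hasSum_averageMap α μ _ y a).unique ?_
  rw [cesaroMap_apply]
  convert! (hasSum_sum (s := Finset.range (n + 1))
    fun k _ => hasSum_averageMap α μ (ψ k) y a).mul_left ((n : ℂ) + 1)⁻¹ using 2 with s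
  rw [cesaroMap_apply, ← Finset.mul_sum]
  ring

theorem almostStationary_nonempty [Nontrivial A] [TopologicalSpace.SeparableSpace A]
    [MeasurableSpace Y] [MeasurableConstSMul Γ Y] (α : Γ →* (A ≃⋆ₐ[ℂ] A)) (μ : PMF Γ) (n : ℕ) :
    (almostStationary (Y := Y) α μ n).Nonempty := by
  obtain ⟨f, hf⟩ := normState_nonempty (A := A)
  let ψ : ℕ → Y → normState A := fun k => (averageMap α μ)^[k] fun _ => ⟨f, hf⟩
  have hsucc (k : ℕ) : averageMap α μ (ψ k) = ψ (k + 1) := (Function.iterate_succ_apply' _ _ _).symm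
  have hm (k : ℕ) : Measurable (ψ k) := by
    induction k with
    | zero => exact measurable_const
    | succ k ih => rw [← hsucc]; exact measurable_averageMap α μ ih
  refine ⟨cesaroMap ψ n, measurable_to_normState fun a => ?_, fun y a => ?_⟩
  · simp only [cesaroMap_apply]
    exact (Finset.measurable_sum _ fun k _ =>
      (measurable_normState_apply a).comp (hm k)).const_mul _
  · rw [averageMap_cesaroMap, cesaroMap_apply, cesaroMap_apply, ← mul_sub,
      ← Finset.sum_sub_distrib]
    simp only [hsucc]
    -- The sum telescopes to its two end terms, each at most `‖a‖`: hence the constant 2.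
    rw [Finset.sum_range_sub fun k => (ψ k y : WeakDual ℂ A) a, norm_mul, norm_inv]
    have h := (norm_sub_le ((ψ (n + 1) y : WeakDual ℂ A) a) ((ψ 0 y : WeakDual ℂ A) a)).trans
      (add_le_add ((ψ (n + 1) y).2.1 a) ((ψ 0 y).2.1 a))
    have hn : ‖(n : ℂ) + 1‖ = n + 1 := by
      exact_mod_cast Complex.norm_natCast (n + 1)
    rw [hn, div_mul_eq_mul_div, inv_mul_eq_div]
    gcongr
    linarith

end Averaging

/-! ### Almost everywhere convergent sequences via `L²`. -/

section Compactness

variable {A Y : Type*} [CStarAlgebra A] [TopologicalSpace.SeparableSpace A] [MeasurableSpace Y]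

theorem memLp_evalSeq {ψ : Y → normState A} (hψ : Measurable ψ) (ν : Measure (Y × ℕ))
    [IsFiniteMeasure ν] : MemLp (fun p : Y × ℕ => evalSeq (ψ p.1) p.2) 2 ν := by
  refine .of_bound (Measurable.aestronglyMeasurable ?_) 1
    (.of_forall fun p => ((ψ p.1).2.1 _).trans (norm_unitBallSeq_le _))
  exact measurable_from_prod_countable_left fun n => (measurable_normState_apply (unitBallSeq A n)).comp hψ

/-- Decreasing midpoint-convex sets of measurable maps into the contractive unital functionals
contain a sequence that converges almost everywhere. -/
theorem exists_ae_tendsto_of_antitone (σ : Measure Y) [IsFiniteMeasure σ]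
    {C : ℕ → Set (Y → normState A)} (hne : ∀ n, (C n).Nonempty) (hanti : Antitone C)
    (hmeas : ∀ n, ∀ ψ ∈ C n, Measurable ψ)
    (hmid : ∀ n, ∀ ψ ∈ C n, ∀ χ ∈ C n, midpointMap ψ χ ∈ C n) :
    ∃ (ψ : ℕ → Y → normState A) (φ : Y → normState A), (∀ n, ψ n ∈ C n) ∧ Measurable φ ∧
      ∀ᵐ y ∂σ, Tendsto (fun n => ψ n y) atTop (𝓝 (φ y)) := by
  -- A finite measure with the null sets of counting measure: almost everywhere in `ℕ` means
  -- everywhere.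
  let κ : Measure ℕ := (Measure.count : Measure ℕ).toFinite
  let ν : Measure (Y × ℕ) := σ.prod κ
  let C' : ℕ → Set (Lp ℂ 2 ν) := fun n =>
    {f | ∃ ψ ∈ C n, f =ᵐ[ν] fun p => evalSeq (ψ p.1) p.2}
  obtain ⟨v, hvC, hv⟩ : ∃ v : ℕ → Lp ℂ 2 ν, (∀ n, v n ∈ C' n) ∧ CauchySeq v := by
    refine exists_cauchySeq_mem_of_antitone (fun n => ?_) (fun m n hmn => ?_) (fun n => ?_)
      (R := measureUnivNNReal ν ^ (2 : ENNReal).toReal⁻¹ * 1) (fun n => ?_)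
    · obtain ⟨ψ, hψ⟩ := hne n
      exact ⟨(memLp_evalSeq (hmeas n ψ hψ) ν).toLp, ψ, hψ, MemLp.coeFn_toLp _⟩
    · rintro f ⟨ψ, hψ, hf⟩
      exact ⟨ψ, hanti hmn hψ, hf⟩
    · rintro f ⟨ψ, hψ, hf⟩ g ⟨χ, hχ, hg⟩
      refine ⟨midpointMap ψ χ, hmid n ψ hψ χ hχ, ?_⟩
      filter_upwards [Lp.coeFn_smul (2⁻¹ : ℝ) (f + g), Lp.coeFn_add f g, hf, hg] with p h1 h2 h3 h4
      rw [h1, Pi.smul_apply, h2, Pi.add_apply, h3, h4, evalSeq, evalSeq, evalSeq,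
        midpointMap_apply, Complex.real_smul]
      push_cast
      rfl
    · rintro f ⟨ψ, hψ, hf⟩
      refine Lp.norm_le_of_ae_bound zero_le_one ?_
      filter_upwards [hf] with p hp
      rw [hp]
      exact ((ψ p.1).2.1 _).trans (norm_unitBallSeq_le _)
  obtain ⟨g, hg⟩ := cauchySeq_tendsto_of_complete hv
  obtain ⟨ns, hns, hlim⟩ := (tendstoInMeasure_of_tendsto_Lp hg).exists_seq_tendsto_ae
  choose ψ hψ hψv using hvC
  have hmem (n : ℕ) : ψ (ns n) ∈ C n := hanti (hns.le_apply) (hψ (ns n))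
  have hlim' : ∀ᵐ p ∂ν, Tendsto (fun n => evalSeq (ψ (ns n) p.1) p.2) atTop (𝓝 (g p)) := by
    filter_upwards [hlim, ae_all_iff.mpr hψv] with p hp hp'
    simpa only [hp'] using hp
  have hconv : ∀ᵐ y ∂σ, ∃ l : normState A, Tendsto (fun n => ψ (ns n) y) atTop (𝓝 l) := by
    filter_upwards [Measure.ae_ae_of_ae_prod hlim'] with y hy
    rw [ae_toFinite, Measure.ae_count_iff] at hy
    have hpi := tendsto_pi_nhds.mpr hy
    obtain ⟨l, hl⟩ := isClosedEmbedding_evalSeq.isClosed_range.mem_of_tendsto hpi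
      (.of_forall fun n => Set.mem_range_self (ψ (ns n) y))
    exact ⟨l, isClosedEmbedding_evalSeq.isInducing.tendsto_nhds_iff.mpr (hl ▸ hpi)⟩
  have : TopologicalSpace.MetrizableSpace (normState A) :=
    isClosedEmbedding_evalSeq.isEmbedding.metrizableSpace
  obtain ⟨φ, hφ, hφlim⟩ := measurable_limit_of_tendsto_metrizable_ae
    (fun n => (hmeas n _ (hmem n)).aemeasurable) hconv
  exact ⟨fun n => ψ (ns n), φ, hmem, hφ, hφlim⟩

end Compactness

/-! ### Passage to the limit. -/

section Stationary

variable {Γ A Y : Type*} [Group Γ] [CStarAlgebra A] [MulAction Γ Y]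

/-- Adding to `η` its countably many translates replaces quasi-invariance: convergence `σ`-almost
everywhere also holds at the points `s⁻¹ • y` entering the average. -/
theorem PMF.exists_isFiniteMeasure_ae_smul [MeasurableSpace Y] [MeasurableConstSMul Γ Y]
    (μ : PMF Γ) (η : Measure Y) [IsFiniteMeasure η] :
    ∃ σ : Measure Y, IsFiniteMeasure σ ∧ ∀ p : Y → Prop, (∀ᵐ y ∂σ, p y) →
      ∀ᵐ y ∂η, p y ∧ ∀ s ∈ μ.support, p (s⁻¹ • y) := by
  have : Countable μ.support := μ.support_countable
  let τ : Measure Y := η + Measure.sum fun s : μ.support => η.map fun y => (s : Γ)⁻¹ • y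
  refine ⟨τ.toFinite, inferInstance, fun p hp => ?_⟩
  rw [ae_toFinite, ae_add_measure_iff, Measure.ae_sum_iff] at hp
  have h (s : μ.support) := ae_of_ae_map (measurable_const_smul (s : Γ)⁻¹).aemeasurable (hp.2 s)
  filter_upwards [hp.1, ae_all_iff.mpr h] with y h1 h2
  exact ⟨h1, fun s hs => h2 ⟨s, hs⟩⟩

/-- Dominated convergence with bound `μ(s)‖a‖`; terms off the support vanish, so convergence is
needed only on it. -/
theorem averageMap_eq_of_tendsto [MeasurableSpace Y] (α : Γ →* (A ≃⋆ₐ[ℂ] A)) (μ : PMF Γ)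
    {ψ : ℕ → Y → normState A} {φ : Y → normState A} (hψ : ∀ n, ψ n ∈ almostStationary α μ n)
    {y : Y} (hy : Tendsto (fun n => ψ n y) atTop (𝓝 (φ y)))
    (hs : ∀ s ∈ μ.support, Tendsto (fun n => ψ n (s⁻¹ • y)) atTop (𝓝 (φ (s⁻¹ • y)))) (a : A) :
    (averageMap α μ φ y : WeakDual ℂ A) a = (φ y : WeakDual ℂ A) a := by
  have heval {z : Y} (hz : Tendsto (fun n => ψ n z) atTop (𝓝 (φ z))) (b : A) :
      Tendsto (fun n => (ψ n z : WeakDual ℂ A) b) atTop (𝓝 ((φ z : WeakDual ℂ A) b)) :=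
    (((WeakDual.eval_continuous b).comp continuous_subtype_val).tendsto (φ z)).comp hz
  have h1 : Tendsto (fun n => (averageMap α μ (ψ n) y : WeakDual ℂ A) a) atTop
      (𝓝 ((averageMap α μ φ y : WeakDual ℂ A) a)) := by
    simp only [← (hasSum_averageMap α μ _ y a).tsum_eq]
    refine tendsto_tsum_of_dominated_convergence (μ.hasSum_toReal.summable.mul_right ‖a‖)
      (fun s => ?_) (.of_forall fun n => norm_toReal_mul_normState_le μ (fun s => ψ n (s⁻¹ • y))
        (fun s => α s⁻¹ a) fun s => (StarAlgEquiv.norm_map (α s⁻¹) a).le)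
    by_cases hsμ : s ∈ μ.support
    · exact (heval (hs s hsμ) _).const_mul _
    · simp [(μ.apply_eq_zero_iff s).mpr hsμ]
  have h2 : Tendsto (fun n => (averageMap α μ (ψ n) y : WeakDual ℂ A) a -
      (ψ n y : WeakDual ℂ A) a) atTop (𝓝 0) := by
    refine squeeze_zero_norm (fun n => (hψ n).2 y a) ?_
    have h := ((tendsto_one_div_add_atTop_nhds_zero_nat (𝕜 := ℝ)).const_mul 2).mul_const ‖a‖
    simpa [div_eq_mul_inv] using h
  exact sub_eq_zero.mp (tendsto_nhds_unique (h1.sub (heval hy a)) h2)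

end Stationary

theorem mainTheorem10 {Γ A Y : Type*} [Group Γ]
    [CStarAlgebra A] [Nontrivial A] [TopologicalSpace.SeparableSpace A]
    (α : Γ →* (A ≃⋆ₐ[ℂ] A))
    [MeasurableSpace Y] [MulAction Γ Y] [MeasurableConstSMul Γ Y]
    (η : MeasureTheory.Measure Y) [MeasureTheory.IsProbabilityMeasure η]
    (μ : PMF Γ) :
    ∃ φ : Y → stateSpace A, Measurable φ ∧ IsStationaryStateMap α μ η φ := by
  obtain ⟨σ, _, hσ⟩ := μ.exists_isFiniteMeasure_ae_smul (Y := Y) η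
  obtain ⟨ψ, φ, hψ, hφ, hlim⟩ := exists_ae_tendsto_of_antitone σ
    (almostStationary_nonempty α μ) (antitone_almostStationary α μ) (fun _ _ h => h.1)
    (fun _ _ h _ h' => midpointMap_mem_almostStationary h h')
  refine ⟨fun y => ⟨φ y, normState_subset_stateSpace (φ y).2⟩, ?_, ?_⟩
  · exact (continuous_inclusion normState_subset_stateSpace).measurable.comp hφ
  · filter_upwards [hσ _ hlim] with y hy a
    have h := hasSum_averageMap α μ φ y a
    rwa [averageMap_eq_of_tendsto α μ hψ hy.1 hy.2 a] at h
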